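/- A \emph{stochastic graph} $G=(U,V,E)$ consists of finite sets $U$ (offline vertices) and $V$ (online vertices), $E=U\times V$, edge probabilities $p_{u,v}\in[0,1]$, real edge weights $w_{u,v}$, and patience values $\ell_v\in\mathbb{Z}_{\ge 0}$. The edges $e\in E$ have independent states $\mathrm{st}(e)$, Bernoulli of parameter $p_e$; $e$ is \emph{active} if $\mathrm{st}(e)=1$. A \emph{relaxed probing algorithm} on $G$ is a (possibly randomized) algorithm, with randomness independent of the edge states, which adaptively probes edges of $G$ in any order, each edge at most once and at most $\ell_v$ edges at each $v\in V$, a probe of $e$ revealing $\mathrm{st}(e)$. It respects commitment: whenever a probe of $(u,v)$ yields an active edge and $v$ is not yet in the current set $\mathcal{M}$ (initially empty), $(u,v)$ is added to $\mathcal{M}$ (even if $u$ is already contained in an edge of $\mathcal{M}$); no other edges are added. It is required that for each $u\in U$ the expected number of edges of $\mathcal{M}$ containing $u$ is at most $1$. Its value is $\mathbb{E}\big[\sum_{(u,v)\in\mathcal{M}} w_{u,v}\big]$, and the relaxed benchmark $\mathrm{OPT}_{rel}(G)$ is the supremum of the values of all relaxed probing algorithms on $G$. The algorithm is \emph{non-adaptive}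 if the sequence of its edge probes is independent of the edge states $(\mathrm{st}(e))_{e\in E}$. For $S\subseteq U$ and $v\in V$ put $p(S,v):=1-\prod_{u\in S}(1-p_{u,v})$, and let $\mathcal{R}_v$ be the collection of non-empty $R\subseteq U$ with $|R|\le \ell_v$. Let $\mathrm{LPOPT}_{rel}(G)$ be the optimum value of the linear program \begin{align*} \text{maximize}\quad & \sum_{u\in U,\,v\in V}\ \sum_{R\in\mathcal{R}_v} w_{u,v}\, z_{u,v}(R)\\ \text{subject to}\quad & \sum_{v\in V}\sum_{R\in\mathcal{R}_v} z_{u,v}(R)\le 1 && \forall u\in U,\\ & \sum_{u\in S} z_{u,v}(R)\le p(S,v)\,\alpha_v(R) && \forall v\in V,\ R\in\mathcal{R}_v,\ S\subseteq R,\\ & \sum_{R\in\mathcal{R}_v}\alpha_v(R)\le 1 && \forall v\in V,\\ & z_{u,v}(R)=0 && \forall v\in V,\ R\in\mathcal{R}_v,\ u\in U\setminus R,\\ & z_{u,v}(R)\ge 0,\quad \alpha_v(R)\ge 0 && \forall u\in U,\ v\in V,\ R\in\mathcal{R}_v. \end{align*} \textbf{Theorem.} For every stochastic graph $G$, the linear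 program attains its optimum, and \[ \mathrm{LPOPT}_{rel}(G)=\mathrm{OPT}_{rel}(G). \] Moreover, there exists a non-adaptive relaxed probing algorithm on $G$ whose value equals $\mathrm{OPT}_{rel}(G)$. -/

import Mathlib

namespace StochasticMatching

/-- A (finite, bipartite, complete) stochastic graph with offline vertices `U`, online vertices `V`
and edge set `U × V`: the edge `(u, v)` is active with probability `prob u v`, it has weight
`weight u v`, and at most `patience v` edges incident to `v` may be probed. A missing edge is an
edge of probability `0`. -/
structure StochasticGraph (U V : Type*) where
  prob : U → V → unitInterval
  weight : U → V → ℝ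
  patience : V → ℕ

/-- A deterministic adaptive way of probing edges from `E`: either stop, or probe the edge `e` and
continue with the first subtree if `e` turns out to be active, with the second one otherwise. -/
inductive DecisionTree (E : Type*) where
  | halt : DecisionTree E
  | probe (e : E) (ifActive ifInactive : DecisionTree E) : DecisionTree E

namespace DecisionTree

variable {E : Type*}

/-- The edges probed, in the order in which they are probed, when the edge states are `st`
(`st e = true` means that `e` is active). -/
def probes (st : E → Bool) : DecisionTree E → List E
  | halt => []
  | probe e a b => e :: (if st e then a.probes st else b.probes st)

/-- Preorder encoding of a decision tree, used for countability only. -/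
def encode : DecisionTree E → List (Option E)
  | halt => [none]
  | probe e a b => some e :: (a.encode ++ b.encode)

theorem encode_append_inj (s t : DecisionTree E) (x y : List (Option E))
    (h : s.encode ++ x = t.encode ++ y) : s = t ∧ x = y := by
  induction s generalizing t x y with
  | halt => cases t <;> simp_all [encode]
  | probe e a b iha ihb =>
    cases t with
    | halt => simp [encode] at h
    | probe e' a' b' =>
      simp only [encode, List.cons_append, List.append_assoc, List.cons.injEq,
        Option.some.injEq] at h
      obtain ⟨he, h⟩ := h
      obtain ⟨ha, h⟩ := iha _ _ _ h
      obtain ⟨hb, h⟩ := ihb _ _ _ h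
      exact ⟨by rw [he, ha, hb], h⟩

instance [Countable E] : Countable (DecisionTree E) :=
  Function.Injective.countable (f := encode) fun s t h =>
    (encode_append_inj s t [] [] (by rw [h])).1

/-- Decision trees carry the discrete σ-algebra (all sets are measurable). -/
instance : MeasurableSpace (DecisionTree E) := ⊤

instance : DiscreteMeasurableSpace (DecisionTree E) := ⟨fun _ => trivial⟩

end DecisionTree

/-- The one-sided matching that commitment forces on an algorithm which makes the probes of a given
list in order: a probe `e = (u, v)` which yields an active edge is added to the matching exactly if
the online vertex `v` is not yet matched, whether or not `u` already is. -/
def oneSidedMatching {U V : Type*} [DecidableEq U] [DecidableEq V]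
    (st : U × V → Bool) (l : List (U × V)) : Finset (U × V) :=
  l.foldl (fun M e => if st e = true ∧ ∀ f ∈ M, f.2 ≠ e.2 then insert e M else M) ∅

namespace StochasticGraph

variable {U V : Type*} [Fintype U] [Fintype V]

/-- The law of the edge states: independent, the state of `(u, v)` being Bernoulli of parameter
`prob u v`. -/
noncomputable def stateLaw (G : StochasticGraph U V) : MeasureTheory.Measure (U × V → Bool) :=
  MeasureTheory.Measure.pi fun e =>
    ProbabilityTheory.bernoulliMeasure true false (G.prob e.1 e.2)

end StochasticGraph

/-- A randomized adaptive probing algorithm on `G`: it draws a decision tree (this uses all of its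
randomness, and is independent of the edge states) and follows it. Whatever the edge states are, no
edge is probed twice and the patience of every online vertex is respected. -/
structure ProbingAlgorithm {U V : Type*} [DecidableEq V] (G : StochasticGraph U V) where
  law : PMF (DecisionTree (U × V))
  nodup : ∀ t ∈ law.support, ∀ st : U × V → Bool, (t.probes st).Nodup
  patient : ∀ t ∈ law.support, ∀ st : U × V → Bool, ∀ v : V,
    (t.probes st).countP (fun e => e.2 = v) ≤ G.patience v

namespace ProbingAlgorithm

variable {U V : Type*} [Fintype U] [Fintype V] [DecidableEq U] [DecidableEq V]
  {G : StochasticGraph U V}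

/-- The joint law of the decision tree drawn by the algorithm and of the edge states. -/
noncomputable def runLaw (A : ProbingAlgorithm G) :
    MeasureTheory.Measure (DecisionTree (U × V) × (U × V → Bool)) :=
  A.law.toMeasure.prod G.stateLaw

/-- The one-sided matching returned in the outcome `ω` (decision tree, edge states). -/
def matching (ω : DecisionTree (U × V) × (U × V → Bool)) : Finset (U × V) :=
  oneSidedMatching ω.2 (ω.1.probes ω.2)

/-- The expected weight of the one-sided matching returned by the algorithm. -/
noncomputable def value (A : ProbingAlgorithm G) : ℝ :=
  ∫ ω, ∑ e ∈ matching ω, G.weight e.1 e.2 ∂A.runLaw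

/-- The expected number of edges of the returned one-sided matching which contain `u`. -/
noncomputable def expectedDegree (A : ProbingAlgorithm G) (u : U) : ℝ :=
  ∫ ω, (((matching ω).filter fun e => e.1 = u).card : ℝ) ∂A.runLaw

/-- A relaxed probing algorithm: every offline vertex is matched at most once in expectation. That
every online vertex is matched at most once, that the matching consists of probed active edges, and
that commitment is respected, is built into `oneSidedMatching`. -/
def IsRelaxed (A : ProbingAlgorithm G) : Prop :=
  ∀ u : U, A.expectedDegree u ≤ 1

/-- The sequence of edge probes is independent of the edge states. -/
def IsNonAdaptive (A : ProbingAlgorithm G) : Prop :=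
  letI : MeasurableSpace (List (U × V)) := ⊤
  ProbabilityTheory.IndepFun
    (fun ω : DecisionTree (U × V) × (U × V → Bool) => ω.1.probes ω.2)
    (fun ω : DecisionTree (U × V) × (U × V → Bool) => ω.2) A.runLaw

end ProbingAlgorithm

namespace StochasticGraph

variable {U V : Type*} [Fintype U] [Fintype V] [DecidableEq U] [DecidableEq V]

/-- The expected values attained by relaxed probing algorithms on `G`. -/
def relaxedValues (G : StochasticGraph U V) : Set ℝ :=
  {x | ∃ A : ProbingAlgorithm G, A.IsRelaxed ∧ A.value = x}

/-- The relaxed benchmark `OPT_rel(G)`. -/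
noncomputable def optRel (G : StochasticGraph U V) : ℝ :=
  sSup G.relaxedValues

/-- `p(S, v)`: the probability that some edge between `v` and `S` is active. -/
noncomputable def probSome (G : StochasticGraph U V) (S : Finset U) (v : V) : ℝ :=
  1 - ∏ u ∈ S, (1 - (G.prob u v : ℝ))

/-- The non-empty sets of at most `ℓ_v` offline vertices. -/
def probeSets (G : StochasticGraph U V) (v : V) : Finset (Finset U) :=
  Finset.univ.filter fun R => R.Nonempty ∧ R.card ≤ G.patience v

/-- Feasibility of `(z, α)` for the linear program LP-rel. Only the values `z u v R` and `α v R`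
with `R ∈ G.probeSets v` are variables of the program; all others are ignored. -/
structure LPRelFeasible (G : StochasticGraph U V) (z : U → V → Finset U → ℝ)
    (α : V → Finset U → ℝ) : Prop where
  offline : ∀ u, ∑ v, ∑ R ∈ G.probeSets v, z u v R ≤ 1
  polymatroid : ∀ v, ∀ R ∈ G.probeSets v, ∀ S ⊆ R, ∑ u ∈ S, z u v R ≤ G.probSome S v * α v R
  online : ∀ v, ∑ R ∈ G.probeSets v, α v R ≤ 1
  supported : ∀ v, ∀ R ∈ G.probeSets v, ∀ u ∉ R, z u v R = 0
  z_nonneg : ∀ u v, ∀ R ∈ G.probeSets v, 0 ≤ z u v R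
  α_nonneg : ∀ v, ∀ R ∈ G.probeSets v, 0 ≤ α v R

/-- The objective of LP-rel. -/
def lpRelObjective (G : StochasticGraph U V) (z : U → V → Finset U → ℝ) : ℝ :=
  ∑ u, ∑ v, ∑ R ∈ G.probeSets v, G.weight u v * z u v R

/-- The objective values of the feasible solutions of LP-rel. -/
def lpRelValues (G : StochasticGraph U V) : Set ℝ :=
  {x | ∃ z α, G.LPRelFeasible z α ∧ G.lpRelObjective z = x}

/-- The optimum `LPOPT_rel(G)` of LP-rel. -/
noncomputable def lpOptRel (G : StochasticGraph U V) : ℝ :=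
  sSup G.lpRelValues

end StochasticGraph

end StochasticMatching

/-! Both value sets equal the image under `marginalWeight` of one polytope `relaxedMarginals`: the
convex hull of the match-probability vectors of fixed probe lists, cut by the degree constraints. A
cycle of inclusions shows this. From algorithm to LP (`value_mem_lpRelValues`): let `R` be the set
that would be probed at `v` were all edges at `v` inactive. It determines which edges can be matched
at `v` and is independent of the states at `v`, so the joint law of `R` and the match at `v` is
LP-feasible. From LP to hull (`marginals_mem_convexHull`): otherwise a linear functional separates.
But greedy probing by decreasing weight attains the polymatroid maximum (`exists_greedy_order`), and
the vertices `v` can be treated separately, so some list does at least as well. From hull to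
algorithm (`exists_nonAdaptive`): draw a list at random and probe it whatever the states are. There
are finitely many lists, so the polytope is compact and the common supremum is attained. -/

open MeasureTheory ProbabilityTheory

namespace StochasticMatching

/-! ### One-sided matchings as first active edges -/

section Matching

variable {U V : Type*} [DecidableEq V]

/-- The first active edge at `v` in the list `l`. -/
def matchedEdge (st : U × V → Bool) (l : List (U × V)) (v : V) : Option (U × V) :=
  l.find? fun f => st f && decide (f.2 = v)

theorem snd_of_matchedEdge {st : U × V → Bool} {l : List (U × V)} {v : V} {e : U × V}
    (h : matchedEdge st l v = some e) : e.2 = v := by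
  have := List.find?_some h
  simp at this
  exact this.2

theorem active_of_matchedEdge {st : U × V → Bool} {l : List (U × V)} {v : V} {e : U × V}
    (h : matchedEdge st l v = some e) : st e = true := by
  have := List.find?_some h
  simp at this
  exact this.1

theorem mem_of_matchedEdge {st : U × V → Bool} {l : List (U × V)} {v : V} {e : U × V}
    (h : matchedEdge st l v = some e) : e ∈ l :=
  List.mem_of_find?_eq_some h

/-- Commitment keeps the first active edge at each online vertex. The induction appends at the end
because a left fold processes the last edge last. -/
theorem mem_oneSidedMatching [DecidableEq U] (st : U × V → Bool) (l : List (U × V)) (e : U × V) :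
    e ∈ oneSidedMatching st l ↔ matchedEdge st l e.2 = some e := by
  induction l using List.reverseRecOn generalizing e with
  | nil => simp [oneSidedMatching, matchedEdge]
  | append_singleton l a ih =>
    have hstep : oneSidedMatching st (l ++ [a]) =
        if st a = true ∧ ∀ f ∈ oneSidedMatching st l, f.2 ≠ a.2 then
          insert a (oneSidedMatching st l) else oneSidedMatching st l := by
      rw [oneSidedMatching, List.foldl_append]
      rfl
    have hfree : (∀ f ∈ oneSidedMatching st l, f.2 ≠ a.2) ↔ matchedEdge st l a.2 = none := by
      rw [Option.eq_none_iff_forall_ne_some]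
      constructor
      · intro h f hf
        have hv := snd_of_matchedEdge hf
        exact h f ((ih f).2 (by rw [hv]; exact hf)) hv
      · intro h f hf hv
        exact h f (by rw [← hv]; exact (ih f).1 hf)
    have happ : ∀ v, matchedEdge st (l ++ [a]) v =
        (matchedEdge st l v).or (if st a = true ∧ a.2 = v then some a else none) := by
      intro v
      simp only [matchedEdge, List.find?_append, List.find?_singleton]
      congr 1
      simp
    rw [hstep, happ]
    simp only [hfree]
    split_ifs with h1 h2 h2
    · rw [Finset.mem_insert, ih, ← h2.2, h1.2]
      simp [eq_comm]
    · rw [Finset.mem_insert, ih]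
      have : e ≠ a := by rintro rfl; exact h2 ⟨h1.1, rfl⟩
      simp [this]
    · rw [ih]
      have h3 : matchedEdge st l e.2 ≠ none := by
        rw [← h2.2]; exact fun h => h1 ⟨h2.1, h⟩
      obtain ⟨f, hf⟩ := Option.ne_none_iff_exists'.1 h3
      simp [hf]
    · rw [ih]; simp

/-- The edge states obtained from `st` by making all edges at `v` inactive. -/
def deactivate (st : U × V → Bool) (v : V) (e : U × V) : Bool :=
  if e.2 = v then false else st e

/-- The two runs can diverge only after probing an active edge at `v`; that edge is in both lists
and already decides the search. -/
theorem DecisionTree.matchedEdge_probes_deactivate (t : DecisionTree (U × V))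
    (st : U × V → Bool) (v : V) :
    matchedEdge st (t.probes (deactivate st v)) v = matchedEdge st (t.probes st) v := by
  induction t with
  | halt => rfl
  | probe e a b iha ihb =>
    simp only [matchedEdge, DecisionTree.probes, List.find?_cons] at *
    by_cases hv : e.2 = v <;> cases hs : st e <;> simp [deactivate, hv, hs, iha, ihb]

/-- The set of offline vertices `u` such that `(u, v)` is probed if all edges at `v` are
inactive. -/
def probedSet [Fintype U] [DecidableEq U] (t : DecisionTree (U × V)) (st : U × V → Bool) (v : V) :
    Finset U :=
  Finset.univ.filter fun u => (u, v) ∈ t.probes (deactivate st v)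

theorem card_probedSet_le [Fintype U] [DecidableEq U] (t : DecisionTree (U × V))
    (st : U × V → Bool) (v : V) :
    (probedSet t st v).card ≤ (t.probes (deactivate st v)).countP (fun e => e.2 = v) := by
  rw [List.countP_eq_length_filter]
  refine le_trans ?_ (List.toFinset_card_le _)
  refine Finset.card_le_card_of_injOn (fun u => (u, v)) ?_ ?_
  · intro u hu
    simpa [probedSet] using hu
  · intro u _ u' _ h
    exact (Prod.mk.inj h).1

theorem mem_probedSet_of_matchedEdge [Fintype U] [DecidableEq U] {t : DecisionTree (U × V)}
    {st : U × V → Bool} {u : U} {v : V} (h : matchedEdge st (t.probes st) v = some (u, v)) :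
    u ∈ probedSet t st v := by
  rw [← t.matchedEdge_probes_deactivate] at h
  simpa [probedSet] using mem_of_matchedEdge h

end Matching

/-! ### Independence of the edge states -/

section StateLaw

variable {U V : Type*} [Fintype U] [Fintype V] (G : StochasticGraph U V)

instance : IsProbabilityMeasure G.stateLaw := by
  unfold StochasticGraph.stateLaw
  infer_instance

theorem iIndepFun_stateLaw : iIndepFun (fun e (st : U × V → Bool) => st e) G.stateLaw :=
  iIndepFun_pi (X := fun _ => id) fun _ => aemeasurable_id

theorem stateLaw_real_inactive (e : U × V) :
    G.stateLaw.real {st | st e = false} = 1 - G.prob e.1 e.2 := by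
  have h := (measurePreserving_eval (fun e : U × V =>
    bernoulliMeasure true false (G.prob e.1 e.2)) e).measureReal_preimage
      (s := {false}) (MeasurableSet.of_discrete.nullMeasurableSet)
  rw [bernoulliMeasure_real_apply_of_notMem_of_mem] at h
  · simpa [StochasticGraph.stateLaw, Set.preimage, Function.eval] using h
  all_goals simp

theorem stateLaw_real_exists_active [DecidableEq U] [DecidableEq V] (S : Finset U) (v : V) :
    G.stateLaw.real {st | ∃ u ∈ S, st (u, v) = true} = G.probSome S v := by
  have h := (iIndepFun_stateLaw G).measure_inter_preimage_eq_mul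
    (S.map ⟨fun u => (u, v), fun _ _ h => (Prod.mk.inj h).1⟩) (sets := fun _ => {false})
    (fun _ _ => MeasurableSet.of_discrete)
  have hc : {st : U × V → Bool | ∃ u ∈ S, st (u, v) = true} =
      (⋂ i ∈ S.map ⟨fun u => (u, v), fun _ _ h => (Prod.mk.inj h).1⟩,
        (fun st : U × V → Bool => st i) ⁻¹' {false})ᶜ := by
    ext st
    simp
    rfl
  rw [hc, probReal_compl_eq_one_sub MeasurableSet.of_discrete, measureReal_def, h,
    ENNReal.toReal_prod, Finset.prod_map, StochasticGraph.probSome]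
  congr 1
  refine Finset.prod_congr rfl fun u _ => ?_
  exact stateLaw_real_inactive G (u, v)

/-- `deactivate st v` reads only edges away from `v`, the other event only edges at `v`: disjoint
blocks of independent coordinates. -/
theorem stateLaw_inter_exists_active [DecidableEq U] [DecidableEq V] (Q : Set (U × V → Bool))
    (S : Finset U) (v : V) :
    G.stateLaw {st | deactivate st v ∈ Q ∧ ∃ u ∈ S, st (u, v) = true} =
      G.stateLaw {st | deactivate st v ∈ Q} * G.stateLaw {st | ∃ u ∈ S, st (u, v) = true} := by
  classical
  have h := (iIndepFun_stateLaw G).indepFun_finset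
    (Finset.univ.filter fun e : U × V => e.2 ≠ v) (Finset.univ.filter fun e : U × V => e.2 = v)
    (Finset.disjoint_filter.2 fun _ _ h => h) fun e => measurable_pi_apply e
  have h' := h.measure_inter_preimage_eq_mul
    {x | (fun e => if h : e ∈ Finset.univ.filter (fun e : U × V => e.2 ≠ v)
      then x ⟨e, h⟩ else false) ∈ Q}
    {x | ∃ u ∈ S, x ⟨(u, v), by simp⟩ = true} MeasurableSet.of_discrete MeasurableSet.of_discrete
  have hQ : ∀ st : U × V → Bool, (fun e => if h : e ∈ Finset.univ.filter
      (fun e : U × V => e.2 ≠ v) then st e else false) = deactivate st v := by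
    intro st; ext e
    by_cases he : e.2 = v <;> simp [deactivate, he]
  simp only [Set.preimage_ofPred_eq, ← Set.ofPred_and, hQ] at h'
  exact h'

end StateLaw

/-! ### From relaxed algorithms to LP solutions -/

namespace ProbingAlgorithm

variable {U V : Type*} [Fintype U] [Fintype V] [DecidableEq U] [DecidableEq V]
  {G : StochasticGraph U V} (A : ProbingAlgorithm G)

instance : IsProbabilityMeasure A.runLaw := by
  unfold runLaw
  infer_instance

theorem ae_mem_support {U V : Type*} [Fintype U] [Fintype V] [DecidableEq V]
    {G : StochasticGraph U V} (A : ProbingAlgorithm G) : ∀ᵐ ω ∂A.runLaw, ω.1 ∈ A.law.support := by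
  have h : ∀ᵐ t ∂A.law.toMeasure, t ∈ A.law.support := by
    rw [ae_iff, PMF.toMeasure_apply_eq_zero_iff _ MeasurableSet.of_discrete]
    exact Set.disjoint_left.2 fun t ht ht' => ht' ht
  exact Measure.quasiMeasurePreserving_fst.ae h

theorem mem_matching {U V : Type*} [DecidableEq U] [DecidableEq V] (ω : DecisionTree (U × V) × (U × V → Bool)) (u : U) (v : V) :
    (u, v) ∈ matching ω ↔ matchedEdge ω.2 (ω.1.probes ω.2) v = some (u, v) :=
  mem_oneSidedMatching _ _ _

/-- The probability that the algorithm returns a one-sided matching containing `e`. -/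
noncomputable def matchProb (e : U × V) : ℝ :=
  A.runLaw.real {ω | e ∈ matching ω}

theorem integral_sum_matching (c : U × V → ℝ) :
    ∫ ω, ∑ e ∈ matching ω, c e ∂A.runLaw = ∑ e, c e * A.matchProb e := by
  have h : ∀ ω : DecisionTree (U × V) × (U × V → Bool), ∑ e ∈ matching ω, c e =
      ∑ e, Set.indicator {ω | e ∈ matching ω} (fun _ => c e) ω := by
    intro ω
    simp [Set.indicator_apply, Finset.sum_ite_mem]
  simp_rw [h]
  rw [integral_finsetSum _ fun e _ => (integrable_const (c e)).indicator MeasurableSet.of_discrete]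
  refine Finset.sum_congr rfl fun e _ => ?_
  rw [integral_indicator_const _ MeasurableSet.of_discrete, smul_eq_mul, mul_comm, matchProb]

theorem value_eq : A.value = ∑ e : U × V, G.weight e.1 e.2 * A.matchProb e :=
  A.integral_sum_matching fun e => G.weight e.1 e.2

theorem expectedDegree_eq (u : U) : A.expectedDegree u = ∑ v, A.matchProb (u, v) := by
  have h := A.integral_sum_matching fun e => if e.1 = u then 1 else 0
  have h' : A.expectedDegree u =
      ∫ ω, ∑ e ∈ matching ω, (if e.1 = u then 1 else 0 : ℝ) ∂A.runLaw := by
    simp [expectedDegree]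
  rw [h', h, Fintype.sum_prod_type]
  rw [Finset.sum_eq_single u]
  · simp
  · intro b _ hb; simp [hb]
  · simp

/-- The source of the factor `p(S, v) α_v(R)` in the LP: independence holds for each fixed tree, and
Fubini averages over trees. -/
theorem runLaw_real_probedSet_inter (v : V) (R S : Finset U) :
    A.runLaw.real {ω | probedSet ω.1 ω.2 v = R ∧ ∃ u ∈ S, ω.2 (u, v) = true} =
      G.probSome S v * A.runLaw.real {ω | probedSet ω.1 ω.2 v = R} := by
  have key : ∀ t : DecisionTree (U × V),
      G.stateLaw {st | probedSet t st v = R ∧ ∃ u ∈ S, st (u, v) = true} =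
        G.stateLaw {st | probedSet t st v = R} *
          G.stateLaw {st | ∃ u ∈ S, st (u, v) = true} := fun t =>
    stateLaw_inter_exists_active G
      {x | (Finset.univ.filter fun u => (u, v) ∈ t.probes x) = R} S v
  have h : A.runLaw {ω | probedSet ω.1 ω.2 v = R ∧ ∃ u ∈ S, ω.2 (u, v) = true} =
      A.runLaw {ω | probedSet ω.1 ω.2 v = R} * G.stateLaw {st | ∃ u ∈ S, st (u, v) = true} := by
    rw [runLaw, Measure.prod_apply MeasurableSet.of_discrete,
      Measure.prod_apply MeasurableSet.of_discrete, ← lintegral_mul_const _ .of_discrete]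
    exact lintegral_congr fun t => key t
  rw [measureReal_def, h, ENNReal.toReal_mul, mul_comm, ← measureReal_def, ← measureReal_def,
    stateLaw_real_exists_active]

theorem sum_measureReal_fiber {Ω ι : Type*} [MeasurableSpace Ω] [DiscreteMeasurableSpace Ω]
    (μ : Measure Ω) [IsFiniteMeasure μ] (g : Ω → ι) (P : Ω → Prop) (F : Finset ι) :
    ∑ R ∈ F, μ.real {ω | g ω = R ∧ P ω} = μ.real {ω | g ω ∈ F ∧ P ω} := by
  rw [← measureReal_biUnion_finset]
  · congr 1; ext ω; simp
  · intro R _ R' _ hR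
    refine Set.disjoint_left.2 fun ω h h' => hR ?_
    exact h.1.symm.trans h'.1
  · exact fun _ _ => MeasurableSet.of_discrete

/-- Restricting to `probeSets` loses no mass: a match at `v` forces the probed set to be non-empty,
and patience bounds its size almost surely. -/
theorem sum_probeSets_eq_matchProb (u : U) (v : V) :
    ∑ R ∈ G.probeSets v, A.runLaw.real
      {ω | probedSet ω.1 ω.2 v = R ∧ matchedEdge ω.2 (ω.1.probes ω.2) v = some (u, v)} =
      A.matchProb (u, v) := by
  rw [sum_measureReal_fiber, matchProb]
  refine measureReal_congr ?_
  filter_upwards [A.ae_mem_support] with ω hω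
  refine propext ⟨fun h => (mem_matching ω u v).2 h.2, fun h => ?_⟩
  have h' := (mem_matching ω u v).1 h
  refine ⟨?_, h'⟩
  simp only [StochasticGraph.probeSets, Finset.mem_filter, Finset.mem_univ, true_and]
  exact ⟨⟨u, mem_probedSet_of_matchedEdge h'⟩,
    (card_probedSet_le _ _ _).trans (A.patient _ hω _ _)⟩

theorem value_mem_lpRelValues (hA : A.IsRelaxed) : A.value ∈ G.lpRelValues := by
  refine ⟨fun u v R => A.runLaw.real
      {ω | probedSet ω.1 ω.2 v = R ∧ matchedEdge ω.2 (ω.1.probes ω.2) v = some (u, v)},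
    fun v R => A.runLaw.real {ω | probedSet ω.1 ω.2 v = R}, ⟨?_, ?_, ?_, ?_, ?_, ?_⟩, ?_⟩
  · intro u
    simp_rw [sum_probeSets_eq_matchProb]
    rw [← expectedDegree_eq]
    exact hA u
  · intro v R _ S _
    -- The events of matching `v` to different `u ∈ S` are disjoint, and each makes some edge
    -- between `S` and `v` active.
    rw [← runLaw_real_probedSet_inter]
    have h := sum_measureReal_fiber A.runLaw
      (fun ω => matchedEdge ω.2 (ω.1.probes ω.2) v) (fun ω => probedSet ω.1 ω.2 v = R)
      (S.map ⟨fun u => some (u, v), fun _ _ h => (Prod.mk.inj (Option.some.inj h)).1⟩)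
    rw [Finset.sum_map] at h
    simp only [and_comm] at h ⊢
    refine (le_of_eq h).trans ?_
    refine measureReal_mono ?_
    rintro ω ⟨h1, h2⟩
    obtain ⟨u, hu, hm⟩ := Finset.mem_map.1 h2
    exact ⟨h1, u, hu, active_of_matchedEdge hm.symm⟩
  · intro v
    have h := sum_measureReal_fiber A.runLaw (fun ω => probedSet ω.1 ω.2 v) (fun _ => True)
      (G.probeSets v)
    simp only [and_true] at h
    rw [h]
    exact measureReal_le_one
  · intro v R _ u hu
    convert measureReal_empty
    refine Set.eq_empty_of_forall_notMem ?_
    rintro ω ⟨h1, h2⟩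
    exact hu (h1 ▸ mem_probedSet_of_matchedEdge h2)
  · exact fun _ _ _ _ => measureReal_nonneg
  · exact fun _ _ _ => measureReal_nonneg
  · simp only [StochasticGraph.lpRelObjective, ← Finset.mul_sum, sum_probeSets_eq_matchProb]
    rw [value_eq, Fintype.sum_prod_type]

end ProbingAlgorithm

end StochasticMatching

open MeasureTheory ProbabilityTheory

namespace StochasticMatching

/-! ### Match probabilities of fixed probe lists -/

section Lists

variable {U V : Type*} [DecidableEq U] [DecidableEq V]

/-- The decision tree which probes the edges of a list in order, whatever their states are. -/
def DecisionTree.chain {E : Type*} (l : List E) : DecisionTree E :=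
  l.foldr (fun e t => .probe e t t) .halt

theorem DecisionTree.probes_chain {E : Type*} (l : List E) (st : E → Bool) :
    (chain l).probes st = l := by
  induction l with
  | nil => rfl
  | cons e l ih =>
    have h : chain (e :: l) = .probe e (chain l) (chain l) := rfl
    rw [h, probes, ih, ite_self]

theorem matchedEdge_filter {U V : Type*} [DecidableEq V] (st : U × V → Bool) (l : List (U × V))
    (v : V) : matchedEdge st (l.filter fun e => e.2 = v) v = matchedEdge st l v := by
  simp only [matchedEdge, List.find?_filter]
  congr 1
  ext e
  by_cases h : e.2 = v <;> simp [h]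

theorem exists_list_filter_eq {U V : Type*} [DecidableEq V] [Fintype V] (m : V → List U) :
    ∃ l : List (U × V), ∀ v, (l.filter fun e => e.2 = v) = (m v).map fun u => (u, v) := by
  have h : ∀ F : Finset V, ∃ l : List (U × V), ∀ v, (l.filter fun e => e.2 = v) =
      if v ∈ F then (m v).map fun u => (u, v) else [] := by
    intro F
    induction F using Finset.induction_on with
    | empty => exact ⟨[], by simp⟩
    | insert a F ha ih =>
      obtain ⟨l, hl⟩ := ih
      refine ⟨(m a).map (fun u => (u, a)) ++ l, fun v => ?_⟩
      rw [List.filter_append, hl]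
      by_cases hv : v = a
      · subst hv
        simp [ha, List.filter_map, Function.comp_def]
      · have hv' : a ≠ v := fun h => hv h.symm
        simp [hv, hv', List.filter_map, Function.comp_def]
  obtain ⟨l, hl⟩ := h Finset.univ
  exact ⟨l, fun v => by simpa using hl v⟩

variable [Fintype U] [Fintype V] (G : StochasticGraph U V)

/-- The lists of edges which a non-adaptive probing algorithm may probe. -/
def validLists (G : StochasticGraph U V) : Set (List (U × V)) :=
  {l | l.Nodup ∧ ∀ v, l.countP (fun e => e.2 = v) ≤ G.patience v}

/-- The probability that `e` is in the one-sided matching if the edges of `l` are probed. -/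
noncomputable def listProb (l : List (U × V)) (e : U × V) : ℝ :=
  G.stateLaw.real {st | e ∈ oneSidedMatching st l}

theorem listProb_eq_zero {l : List (U × V)} {e : U × V} (he : e ∉ l) : listProb G l e = 0 := by
  rw [listProb]
  convert measureReal_empty
  refine Set.eq_empty_of_forall_notMem fun st h => he ?_
  exact mem_of_matchedEdge ((mem_oneSidedMatching _ _ _).1 h)

theorem listProb_congr_filter {l l' : List (U × V)} {e : U × V}
    (h : (l.filter fun f => f.2 = e.2) = l'.filter fun f => f.2 = e.2) :
    listProb G l e = listProb G l' e := by
  simp only [listProb, mem_oneSidedMatching]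
  congr 1
  ext st
  simp only [Set.mem_ofPred_eq]
  rw [← matchedEdge_filter, h, matchedEdge_filter]

theorem listProb_append_singleton {l : List (U × V)} {e f : U × V} (h : e ≠ f) :
    listProb G (l ++ [f]) e = listProb G l e := by
  simp only [listProb, mem_oneSidedMatching]
  congr 1
  ext st
  simp only [Set.mem_ofPred_eq, matchedEdge, List.find?_append, List.find?_singleton]
  cases List.find? (fun f => st f && decide (f.2 = e.2)) l <;> simp [h.symm]

/-- `v` is matched exactly when some listed edge is active. Applied to prefixes, this makes the
polymatroid constraints tight along the probing order. -/
theorem sum_listProb (m : List U) (v : V) :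
    ∑ u ∈ m.toFinset, listProb G (m.map fun u => (u, v)) (u, v) =
      G.probSome m.toFinset v := by
  rw [← stateLaw_real_exists_active]
  have h := ProbingAlgorithm.sum_measureReal_fiber G.stateLaw
      (fun st => matchedEdge st (m.map fun u => (u, v)) v) (fun _ => True)
      (m.toFinset.map ⟨fun u => some (u, v), fun _ _ h => (Prod.mk.inj (Option.some.inj h)).1⟩)
  rw [Finset.sum_map] at h
  simp only [listProb, mem_oneSidedMatching]
  simp only [and_true] at h
  refine (Eq.trans ?_ h).trans ?_
  · rfl
  · congr 1
    ext st
    simp only [Set.mem_ofPred_eq, Finset.mem_map, List.mem_toFinset]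
    constructor
    · rintro ⟨u, hu, h⟩
      exact ⟨u, hu, active_of_matchedEdge h.symm⟩
    · rintro ⟨u, hu, h⟩
      have hs : (matchedEdge st (m.map fun u => (u, v)) v).isSome := by
        rw [matchedEdge, List.find?_isSome]
        exact ⟨(u, v), List.mem_map_of_mem hu, by simp [h]⟩
      obtain ⟨e, he⟩ := Option.isSome_iff_exists.1 hs
      obtain ⟨u', hu', rfl⟩ := List.mem_map.1 (mem_of_matchedEdge he)
      exact ⟨u', hu', he.symm⟩

/-! ### Greedy optimization and separation -/

/-- Probing a set of edges at `v` in the order of decreasing weights maximizes the expected weight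
over the polymatroid given by `G.probSome · v`. -/
theorem exists_greedy_order (v : V) (c : U → ℝ) (R : Finset U) :
    ∃ m : List U, m.Nodup ∧ m.toFinset = R ∧ ∀ (x : U → ℝ) (a : ℝ),
      (∀ S ⊆ R, ∑ u ∈ S, x u ≤ G.probSome S v * a) → ∀ d : ℝ, (∀ u ∈ R, d ≤ c u) →
        ∑ u ∈ R, (c u - d) * x u ≤
          a * ∑ u ∈ R, (c u - d) * listProb G (m.map fun u => (u, v)) (u, v) := by
  -- The lightest vertex is inserted last. The lower bound `d` is kept free so that the induction
  -- hypothesis can be used with `d = c b`.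
  induction R using Finset.induction_on_min_value c with
  | empty => exact ⟨[], by simp⟩
  | insert b s hb hmin ih =>
    obtain ⟨m, hnd, hm, h⟩ := ih
    have hbm : b ∉ m := by rwa [← List.mem_toFinset, hm]
    have hset : (m ++ [b]).toFinset = insert b s := by
      ext u; simp [← hm]
    refine ⟨m ++ [b], ?_, hset, ?_⟩
    · simpa [List.nodup_append, hnd] using fun u hu (h : u = b) => hbm (h ▸ hu)
    intro x a hx d hd
    have h1 := h x a (fun S hS => hx S (hS.trans (Finset.subset_insert _ _))) (c b) hmin
    have h2 := mul_le_mul_of_nonneg_left (hx _ subset_rfl)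
      (sub_nonneg.2 (hd b (Finset.mem_insert_self _ _)))
    -- Abel summation: the first term is handled by induction, the second by the constraint for the
    -- whole set, which the list meets with equality.
    have hsplit : ∀ y : U → ℝ, ∑ u ∈ insert b s, (c u - d) * y u =
        ∑ u ∈ s, (c u - c b) * y u + (c b - d) * ∑ u ∈ insert b s, y u := by
      intro y
      have : ∑ u ∈ s, (c u - c b) * y u = ∑ u ∈ insert b s, (c u - c b) * y u := by
        rw [Finset.sum_insert hb]; simp
      rw [this, Finset.mul_sum, ← Finset.sum_add_distrib]
      exact Finset.sum_congr rfl fun u _ => by ring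
    have hq : ∑ u ∈ s, (c u - c b) * listProb G ((m ++ [b]).map fun u => (u, v)) (u, v) =
        ∑ u ∈ s, (c u - c b) * listProb G (m.map fun u => (u, v)) (u, v) := by
      refine Finset.sum_congr rfl fun u hu => ?_
      rw [List.map_append, List.map_singleton, listProb_append_singleton]
      intro h
      exact hb ((Prod.mk.inj h).1 ▸ hu)
    have hp := sum_listProb G (m ++ [b]) v
    rw [hset] at hp
    rw [hsplit, hsplit, hq, hp, mul_add]
    linarith

/-- A linear functional is at least as large at the expected matching of some valid list as at the
marginals of a feasible solution of LP-rel. -/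
theorem exists_validList_ge {z : U → V → Finset U → ℝ} {α : V → Finset U → ℝ}
    (h : G.LPRelFeasible z α) (c : U × V → ℝ) :
    ∃ l ∈ validLists G, ∑ e : U × V, c e * ∑ R ∈ G.probeSets e.2, z e.1 e.2 R ≤
      ∑ e, c e * listProb G l e := by
  -- Vertices of negative weight are never probed: dropping them only helps, and `d = 0` becomes
  -- admissible.
  choose m hnd hm hgr using fun (v : V) (R : Finset U) =>
    exists_greedy_order G v (fun u => c (u, v)) (R.filter fun u => 0 ≤ c (u, v))
  let g : V → Finset U → ℝ := fun v R => ∑ u ∈ R.filter fun u => 0 ≤ c (u, v),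
    c (u, v) * listProb G ((m v R).map fun u => (u, v)) (u, v)
  have hmax : ∀ v, ∃ R : Finset U, R.card ≤ G.patience v ∧
      ∀ R' : Finset U, R'.card ≤ G.patience v → g v R' ≤ g v R := by
    intro v
    obtain ⟨R, hR, hR'⟩ := (Finset.univ.filter fun R : Finset U => R.card ≤ G.patience v)
      |>.exists_max_image (g v) ⟨∅, by simp⟩
    exact ⟨R, by simpa using hR, fun R' h => hR' R' (by simpa using h)⟩
  choose B hB hBmax using hmax
  obtain ⟨l, hl⟩ := exists_list_filter_eq fun v => m v (B v)
  have hmem : ∀ u v, (u, v) ∈ l ↔ u ∈ m v (B v) := by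
    intro u v
    have : (u, v) ∈ l ↔ (u, v) ∈ l.filter fun e => e.2 = v := by simp
    rw [this, hl]
    simp
  refine ⟨l, ⟨?_, fun v => ?_⟩, ?_⟩
  · rw [List.nodup_iff_count_le_one]
    rintro ⟨u, v⟩
    have h1 : l.count (u, v) = (l.filter fun e => e.2 = v).count (u, v) := by
      rw [List.count_filter]; simp
    rw [h1, hl]
    exact List.nodup_iff_count_le_one.1
      ((hnd v (B v)).map fun _ _ h => (Prod.mk.inj h).1) _
  · rw [List.countP_eq_length_filter, hl, List.length_map,
      ← List.toFinset_card_of_nodup (hnd v (B v)), hm]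
    exact (Finset.card_filter_le _ _).trans (hB v)
  · rw [Fintype.sum_prod_type_right, Fintype.sum_prod_type_right]
    refine Finset.sum_le_sum fun v _ => ?_
    have hg : ∑ u, c (u, v) * listProb G l (u, v) = g v (B v) := by
      rw [← Finset.sum_subset (Finset.subset_univ ((B v).filter fun u => 0 ≤ c (u, v)))]
      · refine Finset.sum_congr rfl fun u _ => ?_
        congr 1
        refine listProb_congr_filter G ?_
        rw [hl]
        simp [List.filter_map, Function.comp_def]
      · intro u _ hu
        rw [listProb_eq_zero, mul_zero]
        rwa [hmem, ← List.mem_toFinset, hm]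
    -- `B v` competes with the empty set. Nonnegativity is what lets the bound `∑ α ≤ 1` be used at
    -- the end.
    have hg0 : 0 ≤ g v (B v) := by
      refine le_of_eq_of_le ?_ (hBmax v ∅ (by simp))
      simp [g]
    rw [hg]
    calc ∑ u, c (u, v) * ∑ R ∈ G.probeSets v, z u v R
        = ∑ R ∈ G.probeSets v, ∑ u, c (u, v) * z u v R := by
          simp only [Finset.mul_sum]; rw [Finset.sum_comm]
      _ ≤ ∑ R ∈ G.probeSets v, α v R * g v (B v) := by
          refine Finset.sum_le_sum fun R hR => ?_
          have h1 : ∑ u, c (u, v) * z u v R ≤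
              ∑ u ∈ R.filter fun u => 0 ≤ c (u, v), c (u, v) * z u v R := by
            rw [Finset.sum_filter, ← Finset.sum_subset (Finset.subset_univ R)]
            · refine Finset.sum_le_sum fun u _ => ?_
              split_ifs with hc
              · exact le_rfl
              · exact mul_nonpos_of_nonpos_of_nonneg (not_le.1 hc).le (h.z_nonneg u v R hR)
            · intro u _ hu
              rw [h.supported v R hR u hu, mul_zero]
          have h2 := hgr v R (fun u => z u v R) (α v R)
            (fun S hS => h.polymatroid v R hR S (hS.trans (Finset.filter_subset _ _))) 0
            (fun u hu => (Finset.mem_filter.1 hu).2)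
          simp only [sub_zero] at h2
          refine (h1.trans h2).trans (mul_le_mul_of_nonneg_left ?_ (h.α_nonneg v R hR))
          exact hBmax v R (Finset.mem_filter.1 hR).2.2
      _ = (∑ R ∈ G.probeSets v, α v R) * g v (B v) := by rw [Finset.sum_mul]
      _ ≤ g v (B v) := mul_le_of_le_one_left hg0 (h.online v)

theorem finite_validLists {U V : Type*} [DecidableEq V] [Finite U] [Finite V]
    (G : StochasticGraph U V) : (validLists G).Finite := by
  classical
  have := Fintype.ofFinite U
  have := Fintype.ofFinite V
  exact
    (Set.finite_coe_iff.1 (inferInstanceAs (Finite {l : List (U × V) // l.Nodup}))).subset fun _ h => h.1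

/-- The hull of finitely many points is closed, so a point outside is strictly separated from it by
a functional, against `exists_validList_ge` with the coefficients of that functional. -/
theorem marginals_mem_convexHull {z : U → V → Finset U → ℝ} {α : V → Finset U → ℝ}
    (h : G.LPRelFeasible z α) :
    (fun e : U × V => ∑ R ∈ G.probeSets e.2, z e.1 e.2 R) ∈
      convexHull ℝ (listProb G '' validLists G) := by
  by_contra hx
  obtain ⟨f, b, hf, hb⟩ := geometric_hahn_banach_closed_point (convex_convexHull ℝ _)
    (((finite_validLists G).image _).isClosed_convexHull ℝ) hx
  have hlin : ∀ y : U × V → ℝ, f y = ∑ e, f (Pi.single e 1) * y e := by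
    intro y
    conv_lhs => rw [pi_eq_sum_univ' y]
    simp [map_sum, mul_comm]
  obtain ⟨l, hl, hle⟩ := exists_validList_ge G h fun e => f (Pi.single e 1)
  have := hf _ (subset_convexHull ℝ _ (Set.mem_image_of_mem _ hl))
  rw [hlin] at this hb
  exact absurd (hle.trans_lt (this.trans hb)) (lt_irrefl _)

/-! ### From convex combinations to non-adaptive algorithms -/

/-- Every convex combination of expected matchings of valid lists is the expected matching of a
non-adaptive algorithm. -/
theorem exists_nonAdaptive {x : U × V → ℝ}
    (hx : x ∈ convexHull ℝ (listProb G '' validLists G)) :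
    ∃ A : ProbingAlgorithm G, A.IsNonAdaptive ∧ A.matchProb = x := by
  obtain ⟨ι, _, w, y, hw, hw1, hy, rfl⟩ := mem_convexHull_iff_exists_fintype.1 hx
  choose l hl hly using hy
  let : MeasurableSpace ι := ⊤
  have hsum : ∑ i, ENNReal.ofReal (w i) = 1 := by
    rw [← ENNReal.ofReal_sum_of_nonneg fun i _ => hw i, hw1, ENNReal.ofReal_one]
  let p : PMF ι := PMF.ofFintype (fun i => ENNReal.ofReal (w i)) hsum
  have hsupp : ∀ t ∈ (p.map fun i => DecisionTree.chain (l i)).support,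
      ∃ i, DecisionTree.chain (l i) = t := by
    intro t ht
    rw [PMF.mem_support_map_iff] at ht
    obtain ⟨i, _, hi⟩ := ht
    exact ⟨i, hi⟩
  let A : ProbingAlgorithm G :=
    { law := p.map fun i => DecisionTree.chain (l i)
      nodup := by
        intro t ht st
        obtain ⟨i, rfl⟩ := hsupp t ht
        rw [DecisionTree.probes_chain]
        exact (hl i).1
      patient := by
        intro t ht st v
        obtain ⟨i, rfl⟩ := hsupp t ht
        rw [DecisionTree.probes_chain]
        exact (hl i).2 v }
  refine ⟨A, ?_, ?_⟩
  · let : MeasurableSpace (List (U × V)) := ⊤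
    -- Chains ignore the states, so the probes almost surely agree with those for the all-inactive
    -- states, which depend on the tree alone.
    have hind : IndepFun
        (fun ω : DecisionTree (U × V) × (U × V → Bool) => ω.1.probes fun _ => false)
        (fun ω => ω.2) A.runLaw :=
      indepFun_prod (X := fun t : DecisionTree (U × V) => t.probes fun _ => false) (Y := id)
        .of_discrete measurable_id
    refine hind.congr ?_ (Filter.EventuallyEq.refl _ _)
    filter_upwards [A.ae_mem_support] with ω hω
    obtain ⟨i, hi⟩ := hsupp ω.1 hω
    simp only [← hi, DecisionTree.probes_chain]
  · ext e
    have h1 : A.runLaw {ω | e ∈ ProbingAlgorithm.matching ω} =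
        ∑ i, ENNReal.ofReal (w i) * G.stateLaw {st | e ∈ oneSidedMatching st (l i)} := by
      have hlaw : A.law.toMeasure = p.toMeasure.map fun i => DecisionTree.chain (l i) :=
        (PMF.toMeasure_map _ p .of_discrete).symm
      rw [ProbingAlgorithm.runLaw, Measure.prod_apply MeasurableSet.of_discrete, hlaw,
        lintegral_map .of_discrete .of_discrete, lintegral_fintype]
      refine Finset.sum_congr rfl fun i _ => ?_
      rw [PMF.toMeasure_apply_singleton _ _ MeasurableSet.of_discrete, mul_comm]
      simp only [p, PMF.ofFintype_apply, ProbingAlgorithm.matching, Set.preimage_ofPred_eq,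
        DecisionTree.probes_chain]
    rw [ProbingAlgorithm.matchProb, measureReal_def, h1, ENNReal.toReal_sum, Finset.sum_apply]
    · refine Finset.sum_congr rfl fun i _ => ?_
      rw [ENNReal.toReal_mul, ENNReal.toReal_ofReal (hw i), ← hly i]
      rfl
    · exact fun i _ => ENNReal.mul_ne_top ENNReal.ofReal_ne_top (measure_ne_top _ _)

/-! ### The common polytope, its compactness and the conclusion -/

/-- The expected matchings of non-adaptive relaxed probing algorithms. -/
def relaxedMarginals : Set (U × V → ℝ) :=
  convexHull ℝ (listProb G '' validLists G) ∩ {x | ∀ u, ∑ v, x (u, v) ≤ 1}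

/-- The weight of a fractional one-sided matching. -/
def marginalWeight (x : U × V → ℝ) : ℝ :=
  ∑ e : U × V, G.weight e.1 e.2 * x e

theorem exists_relaxed_nonAdaptive {x : U × V → ℝ} (hx : x ∈ relaxedMarginals G) :
    ∃ A : ProbingAlgorithm G, A.IsRelaxed ∧ A.IsNonAdaptive ∧ A.value = marginalWeight G x := by
  obtain ⟨A, hA, rfl⟩ := exists_nonAdaptive G hx.1
  refine ⟨A, fun u => ?_, hA, A.value_eq⟩
  rw [A.expectedDegree_eq]
  exact hx.2 u

theorem lpRelValues_subset : G.lpRelValues ⊆ marginalWeight G '' relaxedMarginals G := by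
  rintro _ ⟨z, α, h, rfl⟩
  refine ⟨_, ⟨marginals_mem_convexHull G h, h.offline⟩, ?_⟩
  simp only [marginalWeight, StochasticGraph.lpRelObjective, Fintype.sum_prod_type, Finset.mul_sum]

/-- Closes the cycle through `lpRelValues`; in particular adaptivity gains nothing. -/
theorem relaxedValues_eq : G.relaxedValues = marginalWeight G '' relaxedMarginals G := by
  refine Set.Subset.antisymm ?_ ?_
  · rintro _ ⟨A, hA, rfl⟩
    exact lpRelValues_subset G (A.value_mem_lpRelValues hA)
  · rintro _ ⟨x, hx, rfl⟩
    obtain ⟨A, hA, -, hv⟩ := exists_relaxed_nonAdaptive G hx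
    exact ⟨A, hA, hv⟩

theorem lpRelValues_eq : G.lpRelValues = marginalWeight G '' relaxedMarginals G := by
  refine (lpRelValues_subset G).antisymm ?_
  rw [← relaxedValues_eq]
  rintro _ ⟨A, hA, rfl⟩
  exact A.value_mem_lpRelValues hA

theorem isCompact_relaxedMarginals : IsCompact (relaxedMarginals G) := by
  refine (((finite_validLists G).image _).isCompact_convexHull ℝ).inter_right ?_
  simp only [Set.ofPred_forall]
  exact isClosed_iInter fun u => isClosed_le (by fun_prop) continuous_const

theorem nonempty_relaxedMarginals : (relaxedMarginals G).Nonempty := by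
  refine ⟨listProb G [], subset_convexHull ℝ _ (Set.mem_image_of_mem _ ⟨by simp, by simp⟩), ?_⟩
  intro u
  simp [listProb_eq_zero]

theorem isGreatest_marginalWeight : IsGreatest (marginalWeight G '' relaxedMarginals G)
    (sSup (marginalWeight G '' relaxedMarginals G)) := by
  refine ((isCompact_relaxedMarginals G).image ?_).isGreatest_sSup
    ((nonempty_relaxedMarginals G).image _)
  unfold marginalWeight
  fun_prop

end Lists

end StochasticMatching

theorem theoremA2 {U V : Type*} [Fintype U] [Fintype V] [DecidableEq U] [DecidableEq V]
    (G : StochasticMatching.StochasticGraph U V) :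
    IsGreatest G.lpRelValues G.lpOptRel ∧
    IsLUB G.relaxedValues G.optRel ∧
    G.lpOptRel = G.optRel ∧
    ∃ A : StochasticMatching.ProbingAlgorithm G,
      A.IsRelaxed ∧ A.IsNonAdaptive ∧ A.value = G.optRel := by
  have hgr := StochasticMatching.isGreatest_marginalWeight G
  rw [StochasticMatching.StochasticGraph.lpOptRel, StochasticMatching.StochasticGraph.optRel,
    StochasticMatching.relaxedValues_eq, StochasticMatching.lpRelValues_eq]
  refine ⟨hgr, hgr.isLUB, rfl, ?_⟩
  obtain ⟨x, hx, hval⟩ := hgr.1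
  rw [← hval]
  exact StochasticMatching.exists_relaxed_nonAdaptive G hx
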